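/- Let $G=(V,E)$ be a finite undirected graph (parallel edges and loops allowed), with edge costs $c\colon E\to\mathbb{Q}_+$, edge capacities $u\colon E\to\mathbb{Z}_+$, a terminal set $T\subseteq V$ and requirements $r\colon T\to\mathbb{Z}_+$. For a positive integer $k$, a number is called $1/k$-fractional if its product with $k$ is an integer, and a vector or function is $1/k$-fractional if all of its entries are. A biset is a pair $\hat X=(X,X^+)$ with $X\subseteq X^+\subseteq V$; $\delta(\hat X)$ is the set of edges with one end node in $X$ and the other in $V\setminus X^+$, and $\delta(v)=\delta((\{v\},\{v\}))$ for $v\in V$. Let $f^{\lambda}(\hat X)=r(t)$ if $X=X^+$ and $X\cap T=\{t\}$ for some $t\in T$, and $f^{\lambda}(\hat X)=0$ otherwise. Let $P(f^{\lambda},u)$ be the set of all $x\in\mathbb{Q}_+^E$ with $x(\delta(\hat X)):=\sum_{e\in\delta(\hat X)}x(e)\ge f^{\lambda}(\hat X)$ for every biset $\hat X$ with $X\neq\emptyset$, and $x(e)\le u(e)$ for every $e\in E$. A point $x\in P(f^{\lambda},u)$ is minimal if no $y\in P(f^{\lambda},u)$ with $y\ne x$ satisfies $y(e)\le x(e)$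 for all $e\in E$. Let $\mathcal{A}$ be the set of (undirected) paths connecting two distinct terminals, $\mathcal{A}_t\subseteq\mathcal{A}$ the set of those with end node $t$, and $E(A)$ the edge set of $A\in\mathcal{A}$. A multiflow is a function $\psi\colon\mathcal{A}\to\mathbb{Q}_+$ with $\sum_{A\in\mathcal{A}\colon e\in E(A)}\psi(A)\le u(e)$ for every $e\in E$ and $\sum_{A\in\mathcal{A}_t}\psi(A)\ge r(t)$ for every $t\in T$; its cost is $\sum_{A\in\mathcal{A}}\psi(A)\sum_{e\in E(A)}c(e)$. The cost of $x\in\mathbb{Q}_+^E$ is $\sum_{e\in E}c(e)x(e)$. Lemma. Let $k$ be a positive integer. (1) For each $1/k$-fractional multiflow $\psi$ there is a $1/k$-fractional vector $x\in P(f^{\lambda},u)$ of the same cost as $\psi$. (2) If $x$ is minimal in $P(f^{\lambda},u)$ and $1/(2k)$-fractional, and $x(\delta(v))$ is $1/k$-fractional for each $v\in V\setminus T$, then there is a $1/(2k)$-fractional multiflow $\psi$ such that $x(e)=\sum_{A\in\mathcal{A}\colon e\in E(A)}\psi(A)$ for every $e\in E$. -/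

import Mathlib

namespace TerminalBackup

/-! An undirected graph with node type `V` and edge type `E` is given by the map `ends : E → Sym2 V`
that sends each edge to its unordered pair of end nodes; parallel edges and loops are allowed. -/

section Graph

variable {V E : Type*}

/-- Walks from a node to a node. -/
inductive Walk (ends : E → Sym2 V) : V → V → Type _
  | nil {v : V} : Walk ends v v
  | cons {v w z : V} (e : E) (h : ends e = s(v, w)) (p : Walk ends w z) : Walk ends v z

/-- The list of nodes visited by a walk, in order. -/
def Walk.support {ends : E → Sym2 V} : {v w : V} → Walk ends v w → List V
  | v, _, .nil => [v]
  | v, _, .cons _ _ p => v :: p.support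

/-- The list of edges traversed by a walk, in order. -/
def Walk.edges {ends : E → Sym2 V} : {v w : V} → Walk ends v w → List E
  | _, _, .nil => []
  | _, _, .cons e _ p => e :: p.edges

/-- A path is a walk that repeats no node. -/
def Walk.IsPath {ends : E → Sym2 V} {v w : V} (p : Walk ends v w) : Prop :=
  p.support.Nodup

/-- `A` is the edge set of a path whose end nodes are `v` and `w`. An undirected path with two
distinct end nodes is determined by its edge set, so such paths are represented by their edge
sets. -/
def IsPathBetween (ends : E → Sym2 V) (v w : V) (A : Finset E) : Prop :=
  ∃ p : Walk ends v w, p.IsPath ∧ ∀ e, e ∈ A ↔ e ∈ p.edges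

/-- `A` is a path that connects `t` to a terminal in `T` other than `t`. -/
def IsTerminalPathAt (ends : E → Sym2 V) (T : Set V) (t : V) (A : Finset E) : Prop :=
  ∃ t' ∈ T, t' ≠ t ∧ IsPathBetween ends t t' A

open Classical in
/-- The set of all paths that connect two distinct terminals. -/
noncomputable def terminalPaths [Fintype E] (ends : E → Sym2 V) (T : Set V) :
    Finset (Finset E) :=
  {A | ∃ t ∈ T, IsTerminalPathAt ends T t A}

end Graph

section Bisets

variable {V E : Type*}

/-- A biset: an inner part contained in an outer part. -/
@[ext]
structure Biset (V : Type*) where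
  inner : Set V
  outer : Set V
  inner_subset_outer : inner ⊆ outer

/-- The neighbor of a biset. -/
def Biset.neighbor (X : Biset V) : Set V := X.outer \ X.inner

/-- The biset `({v}, {v})` identified with the node `v`. -/
def Biset.ofNode (v : V) : Biset V := ⟨{v}, {v}, subset_rfl⟩

open Classical in
/-- The set of edges with one end node in the inner part of `X` and the other outside of the outer
part of `X`. -/
noncomputable def cut [Fintype E] (ends : E → Sym2 V) (X : Biset V) : Finset E :=
  {e | ∃ a ∈ X.inner, ∃ b ∉ X.outer, ends e = s(a, b)}

/-- The family of bisets with nonempty inner part whose inner and outer parts both meet the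
terminal set `T` exactly in `t`. -/
def terminalBisets (T : Set V) (t : V) : Set (Biset V) :=
  {X | X.inner.Nonempty ∧ X.inner ∩ T = {t} ∧ X.outer ∩ T = {t}}

open Classical in
/-- The biset function of the edge-connectivity requirements: `r t` if `X` has an empty neighbor
and belongs to `terminalBisets T t` for a terminal `t` (there is at most one), and `0` otherwise. -/
noncomputable def fLambda (T : Set V) (r : V → ℕ) (X : Biset V) : ℕ :=
  if h : ∃ t ∈ T, X ∈ terminalBisets T t ∧ X.neighbor = ∅ then r h.choose else 0

theorem fLambda_eq {T : Set V} {r : V → ℕ} {X : Biset V} {t : V} (ht : t ∈ T)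
    (hX : X ∈ terminalBisets T t) (hn : X.neighbor = ∅) : fLambda T r X = r t := by
  have h : ∃ t ∈ T, X ∈ terminalBisets T t ∧ X.neighbor = ∅ := ⟨t, ht, hX, hn⟩
  have h1 : h.choose = t :=
    Set.singleton_injective (h.choose_spec.2.1.2.1.symm.trans hX.2.1)
  rw [fLambda, dif_pos h, h1]

theorem fLambda_eq_zero {T : Set V} {r : V → ℕ} {X : Biset V}
    (h : ¬ ∃ t ∈ T, X ∈ terminalBisets T t ∧ X.neighbor = ∅) : fLambda T r X = 0 :=
  dif_neg h

/-- The polyhedron of nonnegative rational vectors `x` with `x(e) ≤ u(e)` for each edge `e` that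
cover the biset function `h`: `x(δ(X)) ≥ h(X)` for each biset `X` with nonempty inner part. -/
def coverPolyhedron [Fintype E] (ends : E → Sym2 V) (h : Biset V → ℕ) (u : E → ℕ) :
    Set (E → ℚ≥0) :=
  {x | (∀ X : Biset V, X.inner.Nonempty → (h X : ℚ≥0) ≤ ∑ e ∈ cut ends X, x e) ∧
    ∀ e, x e ≤ (u e : ℚ≥0)}

end Bisets

section Multiflows

variable {V E : Type*} [Fintype E] {ends : E → Sym2 V} {T : Set V}

open Classical in
/-- The total flow of `ψ` through the edge `e`. -/
noncomputable def load (ψ : terminalPaths ends T → ℚ≥0) (e : E) : ℚ≥0 :=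
  ∑ A : terminalPaths ends T with e ∈ A.1, ψ A

open Classical in
/-- The total flow of `ψ` on paths that connect `t` to other terminals. -/
noncomputable def flowAt (ψ : terminalPaths ends T → ℚ≥0) (t : V) : ℚ≥0 :=
  ∑ A : terminalPaths ends T with IsTerminalPathAt ends T t A.1, ψ A

/-- `ψ` is a multiflow satisfying the edge capacities `u` and the flow demands `r`. -/
def IsMultiflow (u : E → ℕ) (r : V → ℕ) (ψ : terminalPaths ends T → ℚ≥0) : Prop :=
  (∀ e, load ψ e ≤ (u e : ℚ≥0)) ∧ ∀ t ∈ T, (r t : ℚ≥0) ≤ flowAt ψ t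

/-- The cost of a multiflow, where the cost of a path is the sum of the costs of its edges. -/
noncomputable def multiflowCost (c : E → ℚ≥0) (ψ : terminalPaths ends T → ℚ≥0) : ℚ≥0 :=
  ∑ A : terminalPaths ends T, ψ A * ∑ e ∈ A.1, c e

end Multiflows

/-- The number `q` is `1/k`-fractional: `k q` is an integer. -/
def IsFractional (k : ℕ) (q : ℚ≥0) : Prop := ∃ n : ℕ, (k : ℚ≥0) * q = n

end TerminalBackup

/-! For (1), the load of `ψ` works: every path at `t` crosses each cut isolating `t`, and double
counting gives the cost.

For (2), scale `x` by `2 * k`. The result `n` is an integral multigraph with even degree at each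
node outside `T`, in which every cut isolating `t` has at least `2 * k * r t` edges. By the
Lovász–Cherkassky theorem (`exists_terminal_packing`) it contains edge-disjoint terminal paths
meeting all these demands at once. Dividing multiplicities by `2 * k` gives a multiflow with load at
most `x`; this load is feasible by (1), so minimality of `x` forces equality.

Lovász–Cherkassky is proved by splitting off: at a node `v` outside `T`, edges `vs` and `vw` are
replaced by one edge `sw`, until every edge joins two terminals. Uncrossing tight sets shows that a
suitable `w` always exists (`Admissible.exists_splittable`). Each edge carries the original edges of
a walk between its ends, so the final edges yield paths in the original graph. -/

namespace TerminalBackup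

/-! ### Cut functions, tight sets and splitting off. -/

section Splitting

variable {V : Type*}

open Classical in
/-- `1` if the edge `z` has exactly one end node in `X`, and `0` otherwise. -/
noncomputable def crossing (X : Finset V) (z : Sym2 V) : ℕ :=
  if ∃ a ∈ X, ∃ b ∉ X, z = s(a, b) then 1 else 0

open Classical in
theorem crossing_mk (X : Finset V) (a b : V) :
    crossing X s(a, b) = if (a ∈ X ↔ b ∈ X) then 0 else 1 := by
  have h : (∃ c ∈ X, ∃ d ∉ X, s(a, b) = s(c, d)) ↔ ¬ (a ∈ X ↔ b ∈ X) := by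
    constructor
    · rintro ⟨c, hc, d, hd, h⟩
      rcases Sym2.eq_iff.1 h with ⟨rfl, rfl⟩ | ⟨rfl, rfl⟩ <;> tauto
    · intro h
      by_cases ha : a ∈ X
      · exact ⟨a, ha, b, by tauto, rfl⟩
      · exact ⟨b, by tauto, a, ha, Sym2.eq_swap⟩
  simp only [crossing, h, ite_not]

/-- The number of edges of the multigraph `L` that have exactly one end node in `X`. -/
noncomputable def cutSize (L : Multiset (Sym2 V)) (X : Finset V) : ℕ :=
  (L.map (crossing X)).sum

@[simp]
theorem cutSize_cons (z : Sym2 V) (L : Multiset (Sym2 V)) (X : Finset V) :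
    cutSize (z ::ₘ L) X = crossing X z + cutSize L X := by
  simp [cutSize]

/-- `X` contains the terminal `t` and no other terminal. -/
def Isolates (T : Set V) (t : V) (X : Finset V) : Prop :=
  t ∈ X ∧ ∀ y ∈ X, y ∈ T → y = t

/-- Requirements `r` on the terminals `T` for which the multigraph `L` satisfies the cut condition,
has the parities of its terminal degrees, and has even degrees at all other nodes. -/
structure Admissible (T : Set V) (r : V → ℕ) (L : Multiset (Sym2 V)) : Prop where
  even_inner : ∀ v ∉ T, Even (cutSize L {v})
  even_terminal : ∀ t ∈ T, Even (r t + cutSize L {t})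
  le_cutSize : ∀ t ∈ T, ∀ X, Isolates T t X → r t ≤ cutSize L X

/-- Loops do not affect admissibility. -/
theorem Admissible.of_cons_loop {T : Set V} {r : V → ℕ} {a : V} {N : Multiset (Sym2 V)}
    (h : Admissible T r (s(a, a) ::ₘ N)) : Admissible T r N := by
  have h1 : ∀ X, cutSize (s(a, a) ::ₘ N) X = cutSize N X := fun X => by simp [crossing_mk]
  exact ⟨fun v hv => h1 {v} ▸ h.even_inner v hv, fun t ht => h1 {t} ▸ h.even_terminal t ht,
    fun t ht X hX => h1 X ▸ h.le_cutSize t ht X hX⟩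

variable [DecidableEq V]

theorem crossing_inter_add_union (X Y : Finset V) (z : Sym2 V) :
    crossing (X ∩ Y) z + crossing (X ∪ Y) z ≤ crossing X z + crossing Y z := by
  induction z with | _ a b
  simp only [crossing_mk, Finset.mem_inter, Finset.mem_union]
  by_cases a ∈ X <;> by_cases a ∈ Y <;> by_cases b ∈ X <;> by_cases b ∈ Y <;> simp [*]

theorem crossing_sdiff_add_sdiff (X Y : Finset V) (z : Sym2 V) :
    crossing (X \ Y) z + crossing (Y \ X) z ≤ crossing X z + crossing Y z := by
  induction z with | _ a b
  simp only [crossing_mk, Finset.mem_sdiff]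
  by_cases a ∈ X <;> by_cases a ∈ Y <;> by_cases b ∈ X <;> by_cases b ∈ Y <;> simp [*]

theorem even_crossing_insert {v : V} {X : Finset V} (hv : v ∉ X) (z : Sym2 V) :
    Even (crossing (insert v X) z + crossing X z + crossing {v} z) := by
  induction z with | _ a b
  simp only [crossing_mk, Finset.mem_insert, Finset.mem_singleton]
  by_cases ha : a = v <;> by_cases hb : b = v
  · subst ha; subst hb; simp
  · subst ha; by_cases hX : b ∈ X <;> simp [*]
  · subst hb; by_cases hX : a ∈ X <;> simp [*]
  · by_cases a ∈ X <;> by_cases b ∈ X <;> simp [*]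

theorem cutSize_inter_add_union (L : Multiset (Sym2 V)) (X Y : Finset V) :
    cutSize L (X ∩ Y) + cutSize L (X ∪ Y) ≤ cutSize L X + cutSize L Y := by
  induction L using Multiset.induction with
  | empty => simp [cutSize]
  | cons z L ih => simp only [cutSize_cons]; have := crossing_inter_add_union X Y z; omega

theorem cutSize_sdiff_add_sdiff (L : Multiset (Sym2 V)) (X Y : Finset V) :
    cutSize L (X \ Y) + cutSize L (Y \ X) ≤ cutSize L X + cutSize L Y := by
  induction L using Multiset.induction with
  | empty => simp [cutSize]
  | cons z L ih => simp only [cutSize_cons]; have := crossing_sdiff_add_sdiff X Y z; omega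

theorem even_cutSize_insert {v : V} {X : Finset V} (hv : v ∉ X) (L : Multiset (Sym2 V)) :
    Even (cutSize L (insert v X) + cutSize L X + cutSize L {v}) := by
  induction L using Multiset.induction with
  | empty => simp [cutSize]
  | cons z L ih =>
    simp only [cutSize_cons]
    have := even_crossing_insert hv z
    rw [Nat.even_iff] at *
    omega

/-- Modulo 2, a cut size is the sum of the degrees inside the set, and only `t` can contribute an
odd term. -/
theorem even_cutSize_disjoint {T : Set V} {L : Multiset (Sym2 V)}
    (hL : ∀ v ∉ T, Even (cutSize L {v})) (t : V) {X : Finset V} (htX : t ∉ X)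
    (hX : ∀ y ∈ X, y ∉ T) : Even (cutSize L {t} + cutSize L (insert t X)) := by
  have hXe : Even (cutSize L X) := by
    clear htX
    induction X using Finset.induction_on with
    | empty =>
      have : ∀ z : Sym2 V, crossing ∅ z = 0 := fun z => by simp [crossing]
      simp [cutSize, this]
    | insert v X hv ih =>
      have h1 := ih fun y hy => hX y (Finset.mem_insert_of_mem hy)
      have h2 := hL v (hX v (Finset.mem_insert_self v X))
      have h3 := even_cutSize_insert hv L
      rw [Nat.even_iff] at *
      omega
  have h3 := even_cutSize_insert htX L
  rw [Nat.even_iff] at *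
  omega

theorem even_cutSize_of_isolates {T : Set V} {L : Multiset (Sym2 V)}
    (hL : ∀ v ∉ T, Even (cutSize L {v})) {t : V} {X : Finset V} (hX : Isolates T t X) :
    Even (cutSize L {t} + cutSize L X) := by
  rw [← Finset.insert_erase hX.1]
  refine even_cutSize_disjoint hL t (Finset.notMem_erase t X) fun y hy hyT => ?_
  exact Finset.ne_of_mem_erase hy (hX.2 y (Finset.mem_of_mem_erase hy) hyT)

theorem Admissible.even_add_cutSize {T : Set V} {r : V → ℕ} {L : Multiset (Sym2 V)}
    (h : Admissible T r L) {t : V} (ht : t ∈ T) {X : Finset V} (hX : Isolates T t X) :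
    Even (r t + cutSize L X) := by
  have h1 := even_cutSize_of_isolates h.even_inner hX
  have h2 := h.even_terminal t ht
  rw [Nat.even_iff] at *
  omega

theorem Isolates.inter {T : Set V} {t : V} {X Y : Finset V} (hX : Isolates T t X)
    (hY : Isolates T t Y) : Isolates T t (X ∩ Y) :=
  ⟨Finset.mem_inter.2 ⟨hX.1, hY.1⟩, fun y hy => hX.2 y (Finset.mem_inter.1 hy).1⟩

theorem Isolates.union {T : Set V} {t : V} {X Y : Finset V} (hX : Isolates T t X)
    (hY : Isolates T t Y) : Isolates T t (X ∪ Y) :=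
  ⟨Finset.mem_union_left _ hX.1, fun y hy =>
    (Finset.mem_union.1 hy).elim (hX.2 y) (hY.2 y)⟩

theorem Isolates.sdiff {T : Set V} {t t' : V} {X Y : Finset V} (ht : t ∈ T) (htt : t ≠ t')
    (hX : Isolates T t X) (hY : Isolates T t' Y) : Isolates T t (X \ Y) :=
  ⟨Finset.mem_sdiff.2 ⟨hX.1, fun h => htt (hY.2 t h ht)⟩,
    fun y hy => hX.2 y (Finset.mem_sdiff.1 hy).1⟩

/-- A set isolating the terminal `t` whose cut meets the requirement of `t` with equality. -/
structure Tight (T : Set V) (r : V → ℕ) (L : Multiset (Sym2 V)) (t : V) (X : Finset V) :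
    Prop where
  mem : t ∈ T
  isolates : Isolates T t X
  cutSize_eq : cutSize L X = r t

section Tight

variable {T : Set V} {r : V → ℕ} {L : Multiset (Sym2 V)} {t t' : V} {X Y : Finset V}

/-- Submodularity: both the intersection and the union have cut at least `r t`, while the two cuts
sum to at most `2 * r t`. -/
theorem Tight.inter (h : Admissible T r L) (hX : Tight T r L t X) (hY : Tight T r L t Y) :
    Tight T r L t (X ∩ Y) := by
  refine ⟨hX.mem, hX.isolates.inter hY.isolates, ?_⟩
  have h1 := h.le_cutSize t hX.mem _ (hX.isolates.inter hY.isolates)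
  have h2 := h.le_cutSize t hX.mem _ (hX.isolates.union hY.isolates)
  have h3 := cutSize_inter_add_union L X Y
  rw [hX.cutSize_eq, hY.cutSize_eq] at h3
  omega

theorem Tight.union (h : Admissible T r L) (hX : Tight T r L t X) (hY : Tight T r L t Y) :
    Tight T r L t (X ∪ Y) := by
  refine ⟨hX.mem, hX.isolates.union hY.isolates, ?_⟩
  have h1 := h.le_cutSize t hX.mem _ (hX.isolates.inter hY.isolates)
  have h2 := h.le_cutSize t hX.mem _ (hX.isolates.union hY.isolates)
  have h3 := cutSize_inter_add_union L X Y
  rw [hX.cutSize_eq, hY.cutSize_eq] at h3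
  omega

/-- For distinct terminals the differences still isolate them, so posimodularity takes the place of
submodularity. -/
theorem Tight.sdiff (h : Admissible T r L) (htt : t ≠ t') (hX : Tight T r L t X)
    (hY : Tight T r L t' Y) : Tight T r L t (X \ Y) := by
  have hXY := Isolates.sdiff hX.mem htt hX.isolates hY.isolates
  refine ⟨hX.mem, hXY, ?_⟩
  have h1 := h.le_cutSize t hX.mem _ hXY
  have h2 := h.le_cutSize t' hY.mem _ (Isolates.sdiff hY.mem htt.symm hY.isolates hX.isolates)
  have h3 := cutSize_sdiff_add_sdiff L X Y
  rw [hX.cutSize_eq, hY.cutSize_eq] at h3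
  omega

/-- An edge between `X \ Y` and `Y \ X` crosses both sets but neither their intersection nor their
union. It would make submodularity strict, which tightness excludes. -/
theorem Tight.notMem_or_mem (h : Admissible T r L) (hX : Tight T r L t X)
    (hY : Tight T r L t Y) {a b : V} (hab : s(a, b) ∈ L) (haX : a ∈ X) (hbX : b ∉ X)
    (hbY : b ∈ Y) : a ∈ Y := by
  by_contra haY
  obtain ⟨M, rfl⟩ := Multiset.exists_cons_of_mem hab
  have h1 := h.le_cutSize t hX.mem _ (hX.isolates.inter hY.isolates)
  have h2 := h.le_cutSize t hX.mem _ (hX.isolates.union hY.isolates)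
  have h3 := cutSize_inter_add_union M X Y
  have h4 := hX.cutSize_eq
  have h5 := hY.cutSize_eq
  simp only [cutSize_cons, crossing_mk, Finset.mem_inter, Finset.mem_union, haX, hbX, hbY, haY]
    at h1 h2 h4 h5
  simp at h1 h2 h4 h5
  omega

/-- An edge from `X ∩ Y` to the outside of `X ∪ Y` crosses neither difference, so for distinct
terminals it would make posimodularity strict. -/
theorem Tight.eq_of_mem_inter (h : Admissible T r L) (hX : Tight T r L t X)
    (hY : Tight T r L t' Y) {a b : V} (hab : s(a, b) ∈ L) (haX : a ∈ X) (haY : a ∈ Y)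
    (hbX : b ∉ X) (hbY : b ∉ Y) : t = t' := by
  by_contra htt
  obtain ⟨M, rfl⟩ := Multiset.exists_cons_of_mem hab
  have h1 := h.le_cutSize t hX.mem _ (Isolates.sdiff hX.mem htt hX.isolates hY.isolates)
  have h2 := h.le_cutSize t' hY.mem _
    (Isolates.sdiff hY.mem (Ne.symm htt) hY.isolates hX.isolates)
  have h3 := cutSize_sdiff_add_sdiff M X Y
  have h4 := hX.cutSize_eq
  have h5 := hY.cutSize_eq
  simp only [cutSize_cons, crossing_mk, Finset.mem_sdiff, haX, hbX, hbY, haY] at h1 h2 h4 h5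
  simp at h1 h2 h4 h5
  omega

end Tight

/-- No edge joins `v` to the rest of `X`, so removing `v` adds no cut edge and loses `vs`. -/
theorem cutSize_erase_lt {L : Multiset (Sym2 V)} {v s : V} {X : Finset V} (hs : s(v, s) ∈ L)
    (hv : v ∈ X) (hsX : s ∉ X) (h : ∀ w, w ≠ v → s(v, w) ∈ L → w ∉ X) :
    cutSize L (X.erase v) < cutSize L X := by
  have key : ∀ M : Multiset (Sym2 V), (∀ w, w ≠ v → s(v, w) ∈ M → w ∉ X) →
      cutSize M (X.erase v) ≤ cutSize M X := by
    intro M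
    induction M using Multiset.induction with
    | empty => simp [cutSize]
    | cons z M ih =>
      intro hM
      have h1 := ih fun w hw hwM => hM w hw (Multiset.mem_cons_of_mem hwM)
      have h2 : crossing (X.erase v) z ≤ crossing X z := by
        induction z with | _ a b
        simp only [crossing_mk, Finset.mem_erase]
        by_cases ha : a = v
        · subst ha
          by_cases hb : b = a
          · simp [hb]
          · simp [hM b hb (Multiset.mem_cons_self _ _), hv]
        · by_cases hb : b = v
          · subst hb
            simp [hM a ha (by rw [Sym2.eq_swap]; exact Multiset.mem_cons_self _ _), hv]
          · by_cases a ∈ X <;> by_cases b ∈ X <;> simp [*]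
      simp only [cutSize_cons]
      omega
  obtain ⟨M, rfl⟩ := Multiset.exists_cons_of_mem hs
  have h1 := key M fun w hw hwM => h w hw (Multiset.mem_cons_of_mem hwM)
  simp only [cutSize_cons, crossing_mk, Finset.mem_erase]
  simp [hv, hsX]
  omega

theorem cutSize_insert_lt {L : Multiset (Sym2 V)} {v s : V} {X : Finset V} (hs : s(v, s) ∈ L)
    (hv : v ∉ X) (hsX : s ∈ X) (h : ∀ w, w ≠ v → s(v, w) ∈ L → w ∈ X) :
    cutSize L (insert v X) < cutSize L X := by
  have key : ∀ M : Multiset (Sym2 V), (∀ w, w ≠ v → s(v, w) ∈ M → w ∈ X) →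
      cutSize M (insert v X) ≤ cutSize M X := by
    intro M
    induction M using Multiset.induction with
    | empty => simp [cutSize]
    | cons z M ih =>
      intro hM
      have h1 := ih fun w hw hwM => hM w hw (Multiset.mem_cons_of_mem hwM)
      have h2 : crossing (insert v X) z ≤ crossing X z := by
        induction z with | _ a b
        simp only [crossing_mk, Finset.mem_insert]
        by_cases ha : a = v
        · subst ha
          by_cases hb : b = a
          · simp [hb]
          · simp [hM b hb (Multiset.mem_cons_self _ _)]
        · by_cases hb : b = v
          · subst hb
            simp [hM a ha (by rw [Sym2.eq_swap]; exact Multiset.mem_cons_self _ _)]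
          · by_cases a ∈ X <;> by_cases b ∈ X <;> simp [*]
      simp only [cutSize_cons]
      omega
  obtain ⟨M, rfl⟩ := Multiset.exists_cons_of_mem hs
  have h1 := key M fun w hw hwM => h w hw (Multiset.mem_cons_of_mem hwM)
  simp only [cutSize_cons, crossing_mk, Finset.mem_insert]
  simp [hv, hsX]
  omega

/-- At a node outside of `T`, every edge can be paired with an edge from which no tight set
separates it. -/
theorem Admissible.exists_splittable [Fintype V] {T : Set V} {r : V → ℕ} {v s : V}
    {M : Multiset (Sym2 V)} (h : Admissible T r (s(v, s) ::ₘ M)) (hv : v ∉ T) (hvs : v ≠ s) :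
    ∃ w, s(v, w) ∈ M ∧ ∀ t X, Tight T r (s(v, s) ::ₘ M) t X →
      (v ∈ X → s ∉ X → w ∈ X) ∧ (v ∉ X → s ∈ X → w ∉ X) := by
  set L := s(v, s) ::ₘ M with hL
  have hsL : s(v, s) ∈ L := Multiset.mem_cons_self _ _
  have hsL' : s(s, v) ∈ L := by rw [Sym2.eq_swap]; exact hsL
  by_contra! hno
  have hno' : ∀ w, s(v, w) ∈ M → ∃ t X, Tight T r L t X ∧
      ((v ∈ X ∧ s ∉ X ∧ w ∉ X) ∨ (v ∉ X ∧ s ∈ X ∧ w ∈ X)) := by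
    intro w hw
    obtain ⟨t, X, hX, h1⟩ := hno w hw
    refine ⟨t, X, hX, ?_⟩
    tauto
  -- The degree of `v` is even and `vs` contributes 1. A loop at `v` may serve here, with `w = v`.
  have hne : ∃ w, s(v, w) ∈ M := by
    by_contra! hM
    have h0 : cutSize M {v} = 0 := by
      refine Multiset.sum_eq_zero fun n hn => ?_
      obtain ⟨z, hz, rfl⟩ := Multiset.mem_map.1 hn
      refine if_neg ?_
      rintro ⟨a, ha, b, -, rfl⟩
      rw [Finset.mem_singleton.1 ha] at hz
      exact hM b hz
    have h1 := h.even_inner v hv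
    rw [hL, cutSize_cons, h0, crossing_mk] at h1
    simp [hvs.symm] at h1
  -- If some tight set contains `v` but not `s`, a minimal one contains no neighbor of `v` other
  -- than possibly `v` itself, and deleting `v` violates the cut condition. Otherwise every
  -- obstructing set contains `s` but not `v`; a maximal such set contains all other neighbors of
  -- `v`, and adding `v` violates the cut condition.
  by_cases hA : ∃ X : Finset V, (∃ t, Tight T r L t X) ∧ v ∈ X ∧ s ∉ X
  · obtain ⟨X, ⟨⟨t, hX⟩, hvX, hsX⟩, hmin⟩ := exists_minimal_of_wellFoundedLT
      (fun X : Finset V => (∃ t, Tight T r L t X) ∧ v ∈ X ∧ s ∉ X) hA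
    have hall : ∀ w, w ≠ v → s(v, w) ∈ L → w ∉ X := by
      intro w _ hw
      rcases Multiset.mem_cons.1 hw with hw | hw
      · rcases Sym2.eq_iff.1 hw with ⟨-, rfl⟩ | ⟨h1, h2⟩
        · exact hsX
        · exact absurd h1 hvs
      · obtain ⟨t', Y, hY, ⟨hvY, hsY, hwY⟩ | ⟨hvY, hsY, hwY⟩⟩ := hno' w hw
        · obtain rfl := hX.eq_of_mem_inter h hY hsL hvX hvY hsX hsY
          have := hmin ⟨⟨t, hX.inter h hY⟩, Finset.mem_inter.2 ⟨hvX, hvY⟩,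
            fun h => hsX (Finset.mem_inter.1 h).1⟩ Finset.inter_subset_left
          exact fun hwX => hwY (Finset.mem_inter.1 (this hwX)).2
        -- With a common terminal, the edge `vs` would join `X \ Y` to `Y \ X`.
        · have htt : t ≠ t' := by
            rintro rfl
            exact hvY (hX.notMem_or_mem h hY hsL hvX hsX hsY)
          have := hmin ⟨⟨t, hX.sdiff h htt hY⟩, Finset.mem_sdiff.2 ⟨hvX, hvY⟩,
            fun h => hsX (Finset.mem_sdiff.1 h).1⟩ Finset.sdiff_subset
          exact fun hwX => (Finset.mem_sdiff.1 (this hwX)).2 hwY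
    have h1 := cutSize_erase_lt hsL hvX hsX hall
    have h2 := h.le_cutSize t hX.mem (X.erase v)
      ⟨Finset.mem_erase.2 ⟨fun h => hv (h ▸ hX.mem), hX.isolates.1⟩,
        fun y hy => hX.isolates.2 y (Finset.mem_of_mem_erase hy)⟩
    rw [hX.cutSize_eq] at h1
    omega
  · have hno2 : ∀ w, s(v, w) ∈ M → ∃ t X, Tight T r L t X ∧ v ∉ X ∧ s ∈ X ∧ w ∈ X := by
      intro w hw
      obtain ⟨t, X, hX, h1 | h1⟩ := hno' w hw
      · exact absurd ⟨X, ⟨t, hX⟩, h1.1, h1.2.1⟩ hA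
      · exact ⟨t, X, hX, h1⟩
    obtain ⟨w₀, hw₀⟩ := hne
    obtain ⟨t₀, X₀, hX₀, hvX₀, hsX₀, -⟩ := hno2 w₀ hw₀
    obtain ⟨X, ⟨⟨t, hX⟩, hvX, hsX⟩, hmax⟩ := exists_maximal_of_wellFoundedGT
      (fun X : Finset V => (∃ t, Tight T r L t X) ∧ v ∉ X ∧ s ∈ X)
      ⟨X₀, ⟨t₀, hX₀⟩, hvX₀, hsX₀⟩
    have hall : ∀ w, w ≠ v → s(v, w) ∈ L → w ∈ X := by
      intro w _ hw
      rcases Multiset.mem_cons.1 hw with hw | hw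
      · rcases Sym2.eq_iff.1 hw with ⟨-, rfl⟩ | ⟨h1, h2⟩
        · exact hsX
        · exact absurd h1 hvs
      · obtain ⟨t', Y, hY, hvY, hsY, hwY⟩ := hno2 w hw
        obtain rfl := hX.eq_of_mem_inter h hY hsL' hsX hsY hvX hvY
        have := hmax ⟨⟨t, hX.union h hY⟩,
          fun h => (Finset.mem_union.1 h).elim hvX hvY,
          Finset.mem_union_left _ hsX⟩ Finset.subset_union_left
        exact this (Finset.mem_union_right _ hwY)
    have h1 := cutSize_insert_lt hsL hvX hsX hall
    have h2 := h.le_cutSize t hX.mem (insert v X)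
      ⟨Finset.mem_insert_of_mem hX.isolates.1, fun y hy hyT =>
        (Finset.mem_insert.1 hy).elim (fun h => absurd (h ▸ hyT) hv)
          fun hy => hX.isolates.2 y hy hyT⟩
    rw [hX.cutSize_eq] at h1
    omega

/-- Splitting off two edges `vs`, `vw` that no tight set separates from each other keeps the
requirements admissible. -/
theorem Admissible.split {T : Set V} {r : V → ℕ} {v s w : V} {N : Multiset (Sym2 V)}
    (h : Admissible T r (s(v, s) ::ₘ s(v, w) ::ₘ N))
    (hw : ∀ t X, Tight T r (s(v, s) ::ₘ s(v, w) ::ₘ N) t X →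
      (v ∈ X → s ∉ X → w ∈ X) ∧ (v ∉ X → s ∈ X → w ∉ X)) :
    Admissible T r (s(s, w) ::ₘ N) := by
  have hcut : ∀ X, (cutSize (s(v, s) ::ₘ s(v, w) ::ₘ N) X = cutSize (s(s, w) ::ₘ N) X) ∨
      (cutSize (s(v, s) ::ₘ s(v, w) ::ₘ N) X = cutSize (s(s, w) ::ₘ N) X + 2 ∧
        ((v ∈ X ∧ s ∉ X ∧ w ∉ X) ∨ (v ∉ X ∧ s ∈ X ∧ w ∈ X))) := by
    intro X
    simp only [cutSize_cons, crossing_mk]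
    by_cases v ∈ X <;> by_cases s ∈ X <;> by_cases w ∈ X <;> simp [*] <;> omega
  have heven : ∀ X, Even (cutSize (s(v, s) ::ₘ s(v, w) ::ₘ N) X + cutSize (s(s, w) ::ₘ N) X) := by
    intro X
    rw [Nat.even_iff]
    rcases hcut X with h1 | ⟨h1, -⟩ <;> omega
  refine ⟨fun v hv => ?_, fun t ht => ?_, fun t ht X hX => ?_⟩
  · have h1 := h.even_inner v hv
    have h2 := heven {v}
    rw [Nat.even_iff] at *
    omega
  · have h1 := h.even_terminal t ht
    have h2 := heven {t}
    rw [Nat.even_iff] at *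
    omega
  · have h1 := h.le_cutSize t ht X hX
    have h2 := h.even_add_cutSize ht hX
    rw [Nat.even_iff] at h2
    rcases hcut X with h3 | ⟨h3, h4⟩
    · omega
    -- The cut drops by 2 only if `X` is not tight, and then parity gives a slack of at least 2.
    · have h5 : cutSize (s(v, s) ::ₘ s(v, w) ::ₘ N) X ≠ r t := by
        intro h6
        have := hw t X ⟨ht, hX, h6⟩
        tauto
      omega

end Splitting

/-! ### Walks, paths and the walks carried by split edges. -/

section Walks

variable {V E : Type*} {ends : E → Sym2 V}

/-- Concatenation of walks. -/
def Walk.append : {a b c : V} → Walk ends a b → Walk ends b c → Walk ends a c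
  | _, _, _, .nil, q => q
  | _, _, _, .cons e h p, q => .cons e h (p.append q)

theorem Walk.edges_append {a b c : V} (p : Walk ends a b) (q : Walk ends b c) :
    (p.append q).edges = p.edges ++ q.edges := by
  induction p with
  | nil => rfl
  | cons e h p ih => simp [Walk.append, Walk.edges, ih]

/-- The reverse of a walk. -/
def Walk.reverse : {a b : V} → Walk ends a b → Walk ends b a
  | _, _, .nil => .nil
  | _, _, .cons e h p => p.reverse.append (.cons e (h.trans Sym2.eq_swap) .nil)

theorem Walk.edges_reverse {a b : V} (p : Walk ends a b) :
    p.reverse.edges = p.edges.reverse := by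
  induction p with
  | nil => rfl
  | cons e h p ih => simp [Walk.reverse, Walk.edges_append, Walk.edges, ih]

theorem Walk.exists_suffix {a b : V} (p : Walk ends a b) {v : V} (hv : v ∈ p.support) :
    ∃ q : Walk ends v b, q.support.Sublist p.support ∧ q.edges ⊆ p.edges := by
  induction p with
  | nil =>
    obtain rfl : v = _ := by simpa [Walk.support] using hv
    exact ⟨.nil, List.Sublist.refl _, List.Subset.refl _⟩
  | cons e h p ih =>
    rcases List.mem_cons.1 hv with rfl | hv
    · exact ⟨.cons e h p, List.Sublist.refl _, List.Subset.refl _⟩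
    · obtain ⟨q, h1, h2⟩ := ih hv
      exact ⟨q, h1.trans (List.sublist_cons_self _ _),
        fun x hx => List.mem_cons_of_mem _ (h2 hx)⟩

theorem Walk.exists_isPath {a b : V} (p : Walk ends a b) :
    ∃ q : Walk ends a b, q.IsPath ∧ q.edges ⊆ p.edges := by
  induction p with
  | nil => exact ⟨.nil, by simp [Walk.IsPath, Walk.support], List.Subset.refl _⟩
  | @cons v w z e h p ih =>
    obtain ⟨q, h1, h2⟩ := ih
    by_cases hv : v ∈ q.support
    · obtain ⟨q', h3, h4⟩ := q.exists_suffix hv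
      exact ⟨q', h1.sublist h3, fun x hx => List.mem_cons_of_mem _ (h2 (h4 hx))⟩
    · exact ⟨.cons e h q, List.nodup_cons.2 ⟨hv, h1⟩, List.cons_subset_cons _ h2⟩

/-- A walk that leaves a set uses an edge with exactly one end node in the set. -/
theorem Walk.exists_mem_edges_leaving {a b : V} (p : Walk ends a b) {X : Set V} (ha : a ∈ X)
    (hb : b ∉ X) : ∃ e ∈ p.edges, ∃ c ∈ X, ∃ d ∉ X, ends e = s(c, d) := by
  induction p with
  | nil => exact absurd ha hb
  | @cons v w z e h p ih =>
    by_cases hw : w ∈ X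
    · obtain ⟨e', h1, h2⟩ := ih hw hb
      exact ⟨e', List.mem_cons_of_mem _ h1, h2⟩
    · exact ⟨e, List.mem_cons_self, v, ha, w, hw, h⟩

theorem IsPathBetween.reverse {a b : V} {A : Finset E} (h : IsPathBetween ends a b A) :
    IsPathBetween ends b a A := by
  classical
  obtain ⟨p, hp, hA⟩ := h
  have hsupp : ∀ {a b c : V} (p : Walk ends a b) (q : Walk ends b c),
      (p.append q).support = p.support.dropLast ++ q.support := by
    intro a b c p q
    induction p with
    | nil => rfl
    | cons e h p ih =>
      have : p.support ≠ [] := by cases p <;> simp [Walk.support]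
      simp [Walk.append, Walk.support, ih, List.dropLast_cons_of_ne_nil this]
  have hlast : ∀ {a b : V} (p : Walk ends a b), ∃ l, p.support = l ++ [b] := by
    intro a b p
    induction p with
    | nil => exact ⟨[], rfl⟩
    | @cons v w z e h p ih => obtain ⟨l, hl⟩ := ih; exact ⟨v :: l, by simp [Walk.support, hl]⟩
  have hrev : ∀ {a b : V} (p : Walk ends a b), p.reverse.support = p.support.reverse := by
    intro a b p
    induction p with
    | nil => rfl
    | cons e h p ih =>
      obtain ⟨l, hl⟩ := hlast p.reverse
      simp only [Walk.reverse, hsupp, Walk.support, List.reverse_cons, ← ih, hl]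
      simp
  refine ⟨p.reverse, ?_, fun e => by simp [hA, Walk.edges_reverse]⟩
  rw [Walk.IsPath, hrev]
  exact List.nodup_reverse.2 hp

/-- `S` is the multiset of edges of a walk between the two end nodes in `z`. -/
def IsTrace (ends : E → Sym2 V) (z : Sym2 V) (S : Multiset E) : Prop :=
  ∃ a b, z = s(a, b) ∧ ∃ p : Walk ends a b, (p.edges : Multiset E) = S

theorem IsTrace.exists_walk {a b : V} {S : Multiset E} (h : IsTrace ends s(a, b) S) :
    ∃ p : Walk ends a b, (p.edges : Multiset E) = S := by
  obtain ⟨c, d, hz, p, hp⟩ := h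
  rcases Sym2.eq_iff.1 hz with ⟨rfl, rfl⟩ | ⟨rfl, rfl⟩
  · exact ⟨p, hp⟩
  · exact ⟨p.reverse, by rw [Walk.edges_reverse, ← hp]; simp⟩

theorem isTrace_single (e : E) : IsTrace ends (ends e) {e} := by
  obtain ⟨a, b, h⟩ : ∃ a b, ends e = s(a, b) := by
    induction h : ends e with | _ a b
    exact ⟨a, b, rfl⟩
  exact ⟨a, b, h, .cons e h .nil, rfl⟩

/-- Splitting at `v` concatenates the two walks; adding multisets preserves the total use of each
original edge. -/
theorem IsTrace.trans {s v w : V} {S S' : Multiset E} (h : IsTrace ends s(v, s) S)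
    (h' : IsTrace ends s(v, w) S') : IsTrace ends s(s, w) (S + S') := by
  rw [Sym2.eq_swap] at h
  obtain ⟨p, rfl⟩ := h.exists_walk
  obtain ⟨q, rfl⟩ := h'.exists_walk
  exact ⟨s, w, rfl, p.append q, by simp [Walk.edges_append]⟩

theorem IsTrace.exists_isPathBetween {a b : V} {S : Multiset E} (h : IsTrace ends s(a, b) S) :
    ∃ A : Finset E, IsPathBetween ends a b A ∧ ∀ e ∈ A, e ∈ S := by
  classical
  obtain ⟨p, rfl⟩ := h.exists_walk
  obtain ⟨q, hq, hqp⟩ := p.exists_isPath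
  exact ⟨q.edges.toFinset, ⟨q, hq, by simp⟩, fun e he => hqp (by simpa using he)⟩

end Walks

/-! ### The Lovász–Cherkassky theorem. -/

section Packing

variable {V E : Type*} [Fintype E] {ends : E → Sym2 V} {T : Set V}

-- Base case of the splitting: each edge joins two distinct terminals, so the path extracted from
-- its walk counts at both ends.
open Classical in
theorem exists_packing_of_terminal_edges (L : Multiset (Sym2 V × Multiset E))
    (hL : ∀ z ∈ L, IsTrace ends z.1 z.2) (hd : ∀ z ∈ L, ¬ z.1.IsDiag)
    (hT : ∀ z ∈ L, ∀ v ∈ z.1, v ∈ T) :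
    ∃ K : Multiset (terminalPaths ends T),
      (∀ e, K.countP (fun A => e ∈ A.1) ≤ (L.map Prod.snd).sum.count e) ∧
      ∀ t ∈ T, cutSize (L.map Prod.fst) {t} ≤
        K.countP (fun A => IsTerminalPathAt ends T t A.1) := by
  induction L using Multiset.induction with
  | empty => exact ⟨0, by simp, by simp [cutSize]⟩
  | cons z L ih =>
    obtain ⟨K, h1, h2⟩ := ih (fun y hy => hL y (Multiset.mem_cons_of_mem hy))
      (fun y hy => hd y (Multiset.mem_cons_of_mem hy))
      (fun y hy => hT y (Multiset.mem_cons_of_mem hy))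
    obtain ⟨⟨a, b⟩, S⟩ := z
    have hz := hL _ (Multiset.mem_cons_self _ _)
    have hab : a ≠ b := hd _ (Multiset.mem_cons_self _ _)
    have ha : a ∈ T := hT _ (Multiset.mem_cons_self _ _) a (Sym2.mem_mk_left a b)
    have hb : b ∈ T := hT _ (Multiset.mem_cons_self _ _) b (Sym2.mem_mk_right a b)
    obtain ⟨A, hA, hAS⟩ := hz.exists_isPathBetween
    have hAa : IsTerminalPathAt ends T a A := ⟨b, hb, hab.symm, hA⟩
    have hAb : IsTerminalPathAt ends T b A := ⟨a, ha, hab, hA.reverse⟩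
    refine ⟨⟨A, by simpa [terminalPaths] using ⟨a, ha, hAa⟩⟩ ::ₘ K, fun e => ?_, fun t ht => ?_⟩
    · have h3 := h1 e
      simp only [Multiset.countP_cons, Multiset.map_cons, Multiset.sum_cons, Multiset.count_add]
      split_ifs with he
      · have : 1 ≤ S.count e := Multiset.one_le_count_iff_mem.2 (hAS e he)
        omega
      · omega
    · have h3 := h2 t ht
      rw [Multiset.map_cons, cutSize_cons, Multiset.countP_cons]
      have h4 : crossing {t} s(a, b) ≤ if IsTerminalPathAt ends T t A then 1 else 0 := by
        by_cases hta : t = a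
        · subst hta
          rw [if_pos hAa, crossing_mk]
          split_ifs <;> simp
        · by_cases htb : t = b
          · subst htb
            rw [if_pos hAb, crossing_mk]
            split_ifs <;> simp
          · simp [crossing_mk, Ne.symm hta, Ne.symm htb]
      exact (Nat.add_le_add h4 h3).trans_eq (Nat.add_comm _ _)

open Classical in
/-- The Lovász–Cherkassky theorem: an inner Eulerian multigraph satisfying the cut condition has a
packing of paths between distinct terminals that meets all requirements simultaneously. -/
theorem exists_terminal_packing [Fintype V] {r : V → ℕ} (L : Multiset (Sym2 V × Multiset E))
    (hL : ∀ z ∈ L, IsTrace ends z.1 z.2) (h : Admissible T r (L.map Prod.fst)) :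
    ∃ K : Multiset (terminalPaths ends T),
      (∀ e, K.countP (fun A => e ∈ A.1) ≤ (L.map Prod.snd).sum.count e) ∧
      ∀ t ∈ T, r t ≤ K.countP (fun A => IsTerminalPathAt ends T t A.1) := by
  -- Both moves, splitting a pair of edges and dropping a loop, reduce the number of edges by one.
  induction hn : L.card using Nat.strong_induction_on generalizing L with | _ n ih
  subst hn
  by_cases hd : ∀ z ∈ L, ¬ z.1.IsDiag
  · by_cases hT : ∀ z ∈ L, ∀ v ∈ z.1, v ∈ T
    · obtain ⟨K, h1, h2⟩ := exists_packing_of_terminal_edges L hL hd hT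
      exact ⟨K, h1, fun t ht => (h.le_cutSize t ht {t}
        ⟨Finset.mem_singleton_self t, fun y hy _ => Finset.mem_singleton.1 hy⟩).trans (h2 t ht)⟩
    · push Not at hT
      obtain ⟨⟨z, S⟩, hz, v, hvz, hv⟩ := hT
      obtain ⟨s, rfl⟩ := hvz
      have hvs : v ≠ s := hd _ hz
      obtain ⟨M, rfl⟩ := Multiset.exists_cons_of_mem hz
      rw [Multiset.map_cons] at h
      obtain ⟨w, hw, htight⟩ := h.exists_splittable hv hvs
      obtain ⟨⟨y, S'⟩, hy, hyw⟩ := Multiset.mem_map.1 hw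
      obtain rfl : y = s(v, w) := hyw
      obtain ⟨N, rfl⟩ := Multiset.exists_cons_of_mem hy
      rw [Multiset.map_cons] at h htight
      have hsplit := h.split htight
      obtain ⟨K, h1, h2⟩ := ih _ (by simp) ((s(s, w), S + S') ::ₘ N) (fun x hx => by
        rcases Multiset.mem_cons.1 hx with rfl | hx
        · exact (hL _ hz).trans (hL _ (Multiset.mem_cons_of_mem hy))
        · exact hL x (Multiset.mem_cons_of_mem (Multiset.mem_cons_of_mem hx)))
        (by simpa using hsplit) rfl
      exact ⟨K, fun e => (h1 e).trans_eq (by simp [add_assoc]), h2⟩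
  · push Not at hd
    obtain ⟨⟨z, S⟩, hz, hzd⟩ := hd
    obtain ⟨M, rfl⟩ := Multiset.exists_cons_of_mem hz
    induction z with | _ a b
    obtain rfl : a = b := hzd
    rw [Multiset.map_cons] at h
    obtain ⟨K, h1, h2⟩ := ih _ (by simp) M
      (fun x hx => hL x (Multiset.mem_cons_of_mem hx)) h.of_cons_loop rfl
    exact ⟨K, fun e => (h1 e).trans (by simp), h2⟩

end Packing

/-! ### From multiflows to covers and back. -/

section Multiflows

variable {V E : Type*} [Fintype E] {ends : E → Sym2 V} {T : Set V}

open Classical in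
theorem sum_cut_ofNode (n : E → ℕ) (X : Finset V) :
    ∑ e ∈ cut ends ⟨X, X, subset_rfl⟩, n e = ∑ e, n e * crossing X (ends e) := by
  rw [cut, Finset.sum_filter]
  refine Finset.sum_congr rfl fun e _ => ?_
  simp [crossing]

theorem IsTerminalPathAt.exists_mem_cut {t : V} {A : Finset E}
    (hA : IsTerminalPathAt ends T t A) {X : Biset V} (hX : X ∈ terminalBisets T t)
    (hn : X.neighbor = ∅) : ∃ e ∈ A, e ∈ cut ends X := by
  obtain ⟨t', ht', htt, p, -, hp⟩ := hA
  have htX : t ∈ X.inner := (hX.2.1.symm.subset rfl).1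
  have htX' : t' ∉ X.inner := fun h => htt (hX.2.1.subset ⟨h, ht'⟩)
  obtain ⟨e, he, a, ha, b, hb, hab⟩ := p.exists_mem_edges_leaving htX htX'
  have hout : X.outer ⊆ X.inner := Set.sdiff_eq_empty.1 hn
  exact ⟨e, (hp e).2 he, by simpa [cut] using ⟨a, ha, b, fun h => hb (hout h), hab⟩⟩

/-- After exchanging the sums, each path at `t` is counted at least once on the right, since it must
leave `X`. -/
theorem flowAt_le_sum_cut (ψ : terminalPaths ends T → ℚ≥0) {t : V} {X : Biset V}
    (hX : X ∈ terminalBisets T t) (hn : X.neighbor = ∅) :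
    flowAt ψ t ≤ ∑ e ∈ cut ends X, load ψ e := by
  classical
  simp only [flowAt, load, Finset.sum_filter]
  rw [Finset.sum_comm]
  refine Finset.sum_le_sum fun A _ => ?_
  split_ifs with hA
  · obtain ⟨e, he, heX⟩ := hA.exists_mem_cut hX hn
    calc ψ A = if e ∈ A.1 then ψ A else 0 := (if_pos he).symm
      _ ≤ _ := Finset.single_le_sum (f := fun e => if e ∈ A.1 then ψ A else 0)
        (fun _ _ => zero_le) heX
  · exact zero_le

theorem IsMultiflow.load_mem_coverPolyhedron {u : E → ℕ} {r : V → ℕ}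
    {ψ : terminalPaths ends T → ℚ≥0} (h : IsMultiflow u r ψ) :
    load ψ ∈ coverPolyhedron ends (fLambda T r) u := by
  refine ⟨fun X _ => ?_, h.1⟩
  by_cases hX : ∃ t ∈ T, X ∈ terminalBisets T t ∧ X.neighbor = ∅
  · obtain ⟨t, ht, hXt, hn⟩ := hX
    rw [fLambda_eq ht hXt hn]
    exact (h.2 t ht).trans (flowAt_le_sum_cut ψ hXt hn)
  · rw [fLambda_eq_zero hX, Nat.cast_zero]
    exact zero_le

theorem isFractional_sum {ι : Type*} {k : ℕ} {s : Finset ι} {f : ι → ℚ≥0}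
    (h : ∀ i ∈ s, IsFractional k (f i)) : IsFractional k (∑ i ∈ s, f i) := by
  choose! n hn using h
  exact ⟨∑ i ∈ s, n i, by rw [Finset.mul_sum, Nat.cast_sum]; exact Finset.sum_congr rfl hn⟩

theorem sum_mul_load (c : E → ℚ≥0) (ψ : terminalPaths ends T → ℚ≥0) :
    ∑ e, c e * load ψ e = multiflowCost c ψ := by
  classical
  simp only [load, multiflowCost, Finset.mul_sum, Finset.sum_filter]
  rw [Finset.sum_comm]
  refine Finset.sum_congr rfl fun A _ => ?_
  simp [mul_comm]

theorem sum_filter_count {α : Type*} [Fintype α] [DecidableEq α] (K : Multiset α) (p : α → Prop)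
    [DecidablePred p] :
    ∑ a with p a, K.count a = K.countP p := by
  induction K using Multiset.induction with
  | empty => simp
  | cons b K ih =>
    simp only [Multiset.count_cons, Multiset.countP_cons, Finset.sum_add_distrib, ih]
    simp [Finset.sum_ite_eq']

/-- The multigraph with `n e` copies of each edge `e`, each labelled by the walk along `e`. -/
def edgeCopies (ends : E → Sym2 V) (n : E → ℕ) : Multiset (Sym2 V × Multiset E) :=
  Finset.univ.val.bind fun e => Multiset.replicate (n e) (ends e, {e})

theorem cutSize_edgeCopies (n : E → ℕ) (X : Finset V) :
    cutSize ((edgeCopies ends n).map Prod.fst) X = ∑ e, n e * crossing X (ends e) := by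
  simp [cutSize, edgeCopies, Multiset.map_bind, Multiset.sum_bind]

theorem sum_edgeCopies [DecidableEq E] (n : E → ℕ) (e : E) :
    ((edgeCopies ends n).map Prod.snd).sum.count e = n e := by
  have : ((edgeCopies ends n).map Prod.snd).sum = ∑ e, n e • {e} := by
    simp [edgeCopies, Multiset.map_bind, Multiset.sum_bind]
  simp [this, Multiset.count_sum', Multiset.count_singleton]

theorem isTrace_of_mem_edgeCopies {n : E → ℕ} {z : Sym2 V × Multiset E}
    (hz : z ∈ edgeCopies ends n) : IsTrace ends z.1 z.2 := by
  obtain ⟨e, -, he⟩ := Multiset.mem_bind.1 hz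
  obtain rfl := Multiset.eq_of_mem_replicate he
  exact isTrace_single e

open Classical in
/-- An integral vector covering the requirements with an even value at every node outside of `T`
dominates an integral packing of paths that meets the requirements. -/
theorem exists_packing_of_cover [Finite V] (n : E → ℕ) (r : V → ℕ)
    (heven : ∀ v ∉ T, Even (∑ e ∈ cut ends (Biset.ofNode v), n e))
    (hcov : ∀ t ∈ T, ∀ X : Biset V, X ∈ terminalBisets T t → X.neighbor = ∅ →
      r t ≤ ∑ e ∈ cut ends X, n e) :
    ∃ K : Multiset (terminalPaths ends T),
      (∀ e, K.countP (fun A => e ∈ A.1) ≤ n e) ∧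
      ∀ t ∈ T, r t ≤ K.countP (fun A => IsTerminalPathAt ends T t A.1) := by
  have := Fintype.ofFinite V
  set L := edgeCopies ends n with hL
  have hcut : ∀ X : Finset V,
      cutSize (L.map Prod.fst) X = ∑ e ∈ cut ends ⟨X, X, subset_rfl⟩, n e := fun X => by
    rw [hL, cutSize_edgeCopies, sum_cut_ofNode]
  have hinner : ∀ v ∉ T, Even (cutSize (L.map Prod.fst) {v}) := fun v hv => by
    rw [hcut]
    have h : (⟨({v} : Finset V), ({v} : Finset V), subset_rfl⟩ : Biset V) = Biset.ofNode v := by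
      simp [Biset.ofNode]
    rw [h]
    exact heven v hv
  -- Each demand is raised by at most 1 to the parity of the degree of `t`. All cuts isolating `t`
  -- share this parity, so the cut condition survives.
  have hadm : Admissible T (fun t => r t + (r t + cutSize (L.map Prod.fst) {t}) % 2)
      (L.map Prod.fst) := by
    refine ⟨hinner, fun t _ => ?_, fun t ht X hX => ?_⟩
    · rw [Nat.even_iff]
      omega
    · have h1 := even_cutSize_of_isolates hinner hX
      have hXT : (X : Set V) ∩ T = {t} := by
        ext y
        constructor
        · rintro ⟨h1, h2⟩
          exact hX.2 y h1 h2
        · rintro rfl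
          exact ⟨hX.1, ht⟩
      have h2 := hcov t ht ⟨X, X, subset_rfl⟩ ⟨⟨t, hX.1⟩, hXT, hXT⟩ Set.sdiff_self
      rw [← hcut] at h2
      rw [Nat.even_iff] at h1
      omega
  obtain ⟨K, h1, h2⟩ := exists_terminal_packing L (fun z hz => isTrace_of_mem_edgeCopies hz) hadm
  exact ⟨K, fun e => (h1 e).trans_eq (sum_edgeCopies n e),
    fun t ht => (Nat.le_add_right _ _).trans (h2 t ht)⟩

end Multiflows

theorem exists_multiflow_of_minimal {V E : Type*} [Finite V] [Fintype E]
    {ends : E → Sym2 V} {u : E → ℕ} {T : Set V} {r : V → ℕ} {k : ℕ} (hk : 0 < k) {x : E → ℚ≥0}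
    (hx : Minimal (fun y => y ∈ coverPolyhedron ends (fLambda T r) u) x)
    (hfrac : ∀ e, IsFractional (2 * k) (x e))
    (hinner : ∀ v ∉ T, IsFractional k (∑ e ∈ cut ends (Biset.ofNode v), x e)) :
    ∃ ψ : terminalPaths ends T → ℚ≥0, IsMultiflow u r ψ ∧
      (∀ A, IsFractional (2 * k) (ψ A)) ∧ ∀ e, x e = load ψ e := by
  classical
  choose n hn using hfrac
  have hk2 : (0 : ℚ≥0) < ((2 * k : ℕ) : ℚ≥0) := by exact_mod_cast (by omega : 0 < 2 * k)
  obtain ⟨K, h1, h2⟩ := exists_packing_of_cover (ends := ends) (T := T) n (fun t => 2 * k * r t)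
    (fun v hv => by
      obtain ⟨m, hm⟩ := hinner v hv
      refine ⟨m, ?_⟩
      -- Scaling by `k` already makes the value at `v` an integer `m`, so scaling by `2 * k` makes
      -- it even.
      have : ((∑ e ∈ cut ends (Biset.ofNode v), n e : ℕ) : ℚ≥0) = ((m + m : ℕ) : ℚ≥0) := by
        rw [Nat.cast_sum, Finset.sum_congr rfl fun e _ => (hn e).symm, ← Finset.mul_sum]
        push_cast
        rw [mul_assoc, hm]
        ring
      exact_mod_cast this)
    (fun t ht X hX hXn => by
      have h := hx.prop.1 X hX.1
      rw [fLambda_eq ht hX hXn] at h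
      have : ((2 * k * r t : ℕ) : ℚ≥0) ≤ ((∑ e ∈ cut ends X, n e : ℕ) : ℚ≥0) := by
        rw [Nat.cast_sum, Finset.sum_congr rfl fun e _ => (hn e).symm, ← Finset.mul_sum,
          Nat.cast_mul]
        exact mul_le_mul_right h _
      exact_mod_cast this)
  set ψ : terminalPaths ends T → ℚ≥0 := fun A => K.count A / ((2 * k : ℕ) : ℚ≥0) with hψ
  have hsum : ∀ (p : terminalPaths ends T → Prop) [DecidablePred p],
      ∑ A with p A, ψ A = K.countP p / ((2 * k : ℕ) : ℚ≥0) := fun p _ => by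
    rw [hψ, ← sum_filter_count, Nat.cast_sum, Finset.sum_div]
  have hload : ∀ e, load ψ e ≤ x e := fun e => by
    rw [load, hsum, div_le_iff₀ hk2, mul_comm, hn]
    exact_mod_cast h1 e
  have hflow : IsMultiflow u r ψ := by
    refine ⟨fun e => (hload e).trans (hx.prop.2 e), fun t ht => ?_⟩
    rw [flowAt, hsum, le_div_iff₀ hk2, mul_comm]
    exact_mod_cast h2 t ht
  refine ⟨ψ, hflow, fun A => ⟨K.count A, mul_div_cancel₀ _ hk2.ne'⟩, fun e => ?_⟩
  -- The load is itself a feasible point below `x`, so minimality gives the reverse inequality.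
  exact le_antisymm (hx.le_of_le hflow.load_mem_coverPolyhedron hload e) (hload e)

end TerminalBackup

theorem mainTheorem6 {V E : Type*} [Finite V] [Fintype E] (ends : E → Sym2 V)
    (c : E → ℚ≥0) (u : E → ℕ) (T : Set V) (r : V → ℕ) (k : ℕ) (hk : 0 < k) :
    (∀ ψ : TerminalBackup.terminalPaths ends T → ℚ≥0,
      TerminalBackup.IsMultiflow u r ψ →
      (∀ A, TerminalBackup.IsFractional k (ψ A)) →
      ∃ x ∈ TerminalBackup.coverPolyhedron ends (TerminalBackup.fLambda T r) u,
        (∀ e, TerminalBackup.IsFractional k (x e)) ∧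
        ∑ e, c e * x e = TerminalBackup.multiflowCost c ψ) ∧
    (∀ x : E → ℚ≥0,
      Minimal (fun y => y ∈ TerminalBackup.coverPolyhedron ends
        (TerminalBackup.fLambda T r) u) x →
      (∀ e, TerminalBackup.IsFractional (2 * k) (x e)) →
      (∀ v ∉ T, TerminalBackup.IsFractional k
        (∑ e ∈ TerminalBackup.cut ends (TerminalBackup.Biset.ofNode v), x e)) →
      ∃ ψ : TerminalBackup.terminalPaths ends T → ℚ≥0,
        TerminalBackup.IsMultiflow u r ψ ∧
        (∀ A, TerminalBackup.IsFractional (2 * k) (ψ A)) ∧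
        ∀ e, x e = TerminalBackup.load ψ e) := by
  refine ⟨fun ψ hψ hfrac => ?_, fun x hx hfrac hinner =>
    TerminalBackup.exists_multiflow_of_minimal hk hx hfrac hinner⟩
  exact ⟨TerminalBackup.load ψ, hψ.load_mem_coverPolyhedron,
    fun e => TerminalBackup.isFractional_sum fun A _ => hfrac A,
    TerminalBackup.sum_mul_load c ψ⟩
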